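/- Let $X$ be a real Banach space (finite- or infinite-dimensional) with $\dim X>2$. An invariant subspace of a bounded linear operator $T:X\to X$ means a closed linear subspace $L\subset X$ with $L\ne\{0\}$, $L\ne X$ and $T(L)\subseteq L$. (1) Let $T:X\to X$ be a bounded linear operator with bounded inverse such that, for some real number $k$, $\|T^n\|=o(|n|^k)$ as $n\to+\infty$ and as $n\to-\infty$. Then $T$ has an invariant subspace. (2) In particular, every linear isometry $T:X\to X$ (that is, every linear map with $\|Tx\|=\|x\|$ for all $x\in X$, not necessarily surjective) has an invariant subspace. -/

import Mathlib

open Filter Asymptotics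

/-- `T` has an invariant subspace: a closed linear subspace `L`, different from `{0}` and from the
whole space, that `T` maps into itself. -/
def HasInvariantSubspace {X : Type*} [NormedAddCommGroup X] [NormedSpace ℝ X]
    (T : X →L[ℝ] X) : Prop :=
  ∃ L : Submodule ℝ X, IsClosed (L : Set X) ∧ L ≠ ⊥ ∧ L ≠ ⊤ ∧ ∀ x ∈ L, T x ∈ L

/-! Put `A = (T + T⁻¹)/2`. For smooth `F`, the even function `F (cos θ)` has real, rapidly decaying
Fourier coefficients `c n`, so `F(A) = ∑ c n • T ^ n` converges when `‖T ^ n‖` grows polynomially.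
Using the cosine keeps the calculus over `ℝ`, with no complexification. It is multiplicative, its
values commute with `T`, and its norm is controlled by `K + 2` derivatives of `F` on `[-1, 1]`.

Suppose `T` has no invariant subspace. Kernels of operators commuting with `T` are closed and
invariant, so every nonzero such operator is injective. Hence `F * G = 0` forces `F(A) = 0` or `G(A)
= 0`, and the calculus lives at one point `t` (`exists_local_of_prime`). Being of finite order, it
makes `A - t` nilpotent (`isNilpotent_of_local`). A nilpotent operator is not injective, so `A = t`,
that is, `T² = 2tT - 1`; then `x` and `T x` span an invariant subspace of dimension at most 2.

A surjective isometry has bounded powers; a non-surjective one leaves its range invariant. -/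

open Real MeasureTheory AddCircle
open scoped ContDiff Topology ComplexConjugate

/-! ### Fourier coefficients on the circle: decay, reality, convolution. -/

section Fourier

instance fact_zero_lt_two_pi : Fact ((0 : ℝ) < 2 * π) := ⟨two_pi_pos⟩

lemma fourierCoeffOn_norm_le {f : ℝ → ℂ} {M : ℝ} (hM : ∀ x, ‖f x‖ ≤ M) (n : ℤ) :
    ‖fourierCoeffOn (lt_add_of_pos_right (0 : ℝ) two_pi_pos) f n‖ ≤ M := by
  rw [fourierCoeffOn_eq_integral, norm_smul]
  have h := intervalIntegral.norm_integral_le_of_norm_le_const (a := 0) (b := 0 + 2 * π) (C := M)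
    (f := fun x : ℝ => fourier (-n) (x : AddCircle (0 + 2 * π - 0)) • f x) (fun x _ => by
      rw [norm_smul, fourier_apply, Circle.norm_coe, one_mul]; exact hM x)
  have hp : (0 : ℝ) < 0 + 2 * π - 0 := by simpa using two_pi_pos
  rw [abs_of_pos hp] at h
  rw [norm_of_nonneg (by positivity)]
  calc _ ≤ 1 / (0 + 2 * π - 0) * (M * (0 + 2 * π - 0)) := by gcongr
    _ = M := by field_simp

/-- Each integration by parts gains a factor `1 / |n|`; periodicity kills the boundary term. -/
lemma fourierCoeffOn_decay {M : ℝ} (j : ℕ) {n : ℤ} (hn : n ≠ 0) {f : ℝ → ℂ}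
    (hf : ContDiff ℝ j f) (hper : Function.Periodic f (2 * π))
    (hM : ∀ x, ‖iteratedDeriv j f x‖ ≤ M) :
    ‖fourierCoeffOn (lt_add_of_pos_right (0 : ℝ) two_pi_pos) f n‖ ≤ M / |(n : ℝ)| ^ j := by
  induction j generalizing f with
  | zero => simpa using fourierCoeffOn_norm_le (by simpa using hM) n
  | succ j ih =>
    have hd : ContDiff ℝ j (deriv f) := by
      have : ContDiff ℝ (j + 1) f := by exact_mod_cast hf
      exact (contDiff_succ_iff_deriv.1 this).2.2
    have hdiff : Differentiable ℝ f := hf.differentiable (by simp)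
    have hper' : Function.Periodic (deriv f) (2 * π) := fun x => by
      have : (fun y => f (y + 2 * π)) = f := funext hper
      rw [← deriv_comp_add_const, this]
    have h := ih hd hper' (fun x => by rw [← iteratedDeriv_succ']; exact hM x)
    rw [fourierCoeffOn_of_hasDerivAt (lt_add_of_pos_right (0 : ℝ) two_pi_pos) hn
      (fun x _ => (hdiff x).hasDerivAt) (hd.continuous.intervalIntegrable _ _), hper 0]
    have hn' : 0 < |(n : ℝ)| := by simpa using hn
    have hp := pi_pos
    simp only [sub_self, mul_zero, zero_sub, norm_mul, norm_neg, norm_div, Complex.norm_I]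
    simp only [norm_one, Complex.norm_real, Complex.norm_ofNat, norm_eq_abs, abs_of_pos hp,
      Complex.norm_intCast]
    rw [show ‖((0 + 2 * π : ℝ) : ℂ) - ((0 : ℝ) : ℂ)‖ = 2 * π by
      rw [← Complex.ofReal_sub, Complex.norm_real, norm_eq_abs, abs_of_pos (by linarith)]; ring]
    rw [pow_succ, ← div_div (M : ℝ)]
    calc _ = ‖fourierCoeffOn (lt_add_of_pos_right (0 : ℝ) two_pi_pos) (deriv f) n‖ / |(n : ℝ)| := by
          field_simp
      _ ≤ _ := div_le_div_of_nonneg_right h hn'.le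

lemma fourierCoeff_eq_fourierCoeffOn (f : AddCircle (2 * π) → ℂ) (n : ℤ) :
    fourierCoeff f n = fourierCoeffOn (lt_add_of_pos_right (0 : ℝ) two_pi_pos)
      (fun x : ℝ => f x) n := by
  rw [← fourierCoeff_liftIoc_eq]
  congr 1
  ext x
  obtain ⟨y, hy, rfl⟩ : ∃ y ∈ Set.Ioc (0 : ℝ) (0 + 2 * π), (y : AddCircle (2 * π)) = x :=
    ⟨_, (AddCircle.equivIoc (2 * π) 0 x).2, (AddCircle.equivIoc (2 * π) 0).symm_apply_apply x⟩
  rw [AddCircle.liftIoc_coe_apply hy]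

lemma fourierCoeff_im_eq_zero {f : AddCircle (2 * π) → ℂ} (hf : ∀ x, f (-x) = conj (f x)) (n : ℤ) :
    (fourierCoeff f n).im = 0 := by
  rw [← Complex.conj_eq_iff_im, fourierCoeff, ← integral_conj,
    ← integral_neg_eq_self (fun t => fourier (-n) t • f t)]
  refine integral_congr_ae (ae_of_all _ fun t => ?_)
  simp only [smul_eq_mul, map_mul, hf]
  congr 1
  rw [← fourier_neg]
  simp [fourier_apply]

lemma exists_continuousLinearMap_fourierCoeff (n : ℤ) : ∃ L : C(AddCircle (2 * π), ℂ) →L[ℂ] ℂ,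
    ∀ f, L f = fourierCoeff f n := by
  have hint : ∀ f : C(AddCircle (2 * π), ℂ), Integrable f haarAddCircle := fun f =>
    f.continuous.integrable_of_hasCompactSupport (HasCompactSupport.of_compactSpace _)
  refine ⟨LinearMap.mkContinuous
    { toFun := fun f => fourierCoeff f n
      map_add' := fun f g => by
        rw [ContinuousMap.coe_add, fourierCoeff.add (hint f) (hint g)]; rfl
      map_smul' := fun c f => fourierCoeff.const_smul _ _ _ } 1 fun f => ?_, fun f => rfl⟩
  have h := norm_integral_le_of_norm_le_const (μ := haarAddCircle (T := 2 * π)) (C := ‖f‖)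
    (f := fun t => fourier (-n) t • f t) (ae_of_all _ fun t => by
      rw [norm_smul, fourier_apply, Circle.norm_coe, one_mul]; exact f.norm_coe_le_norm t)
  simpa [fourierCoeff] using h

lemma fourierCoeff_fourier_mul (f : AddCircle (2 * π) → ℂ) (m n : ℤ) :
    fourierCoeff (fun x => fourier m x * f x) n = fourierCoeff f (n - m) := by
  unfold fourierCoeff
  congr 1
  ext t
  rw [smul_eq_mul, smul_eq_mul, ← mul_assoc, ← fourier_add]
  congr 3
  ring

/-- The Fourier series of `f` converges uniformly; multiply it by `g` and apply the continuous
functional "`n`-th coefficient" termwise. -/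
lemma hasSum_fourierCoeff_mul {f : C(AddCircle (2 * π), ℂ)} (hf : Summable (fourierCoeff f))
    (g : C(AddCircle (2 * π), ℂ)) (n : ℤ) :
    HasSum (fun m => fourierCoeff f m * fourierCoeff g (n - m))
      (fourierCoeff (fun x => f x * g x) n) := by
  obtain ⟨L, hL⟩ := exists_continuousLinearMap_fourierCoeff n
  have h := ((hasSum_fourier_series_of_summable hf).mul_right g).mapL L
  rw [hL] at h
  change HasSum _ (fourierCoeff (fun x => f x * g x) n) at h
  convert h using 2 with m
  rw [smul_mul_assoc, map_smul, hL, ContinuousMap.coe_mul, smul_eq_mul]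
  congr 1
  exact (fourierCoeff_fourier_mul g m n).symm

end Fourier

/-! ### Fourier coefficients of `F (cos θ)`. -/

section Coefficients

/-- The pull-back of a real function under the cosine, as a complex function on the circle. -/
noncomputable def cosPullback (F : ℝ → ℝ) (x : AddCircle (2 * π)) : ℂ :=
  ((F (Real.Angle.cos x) : ℝ) : ℂ)

/-- The Fourier coefficients of `θ ↦ F (cos θ)`. -/
noncomputable def cosCoeff (F : ℝ → ℝ) (n : ℤ) : ℝ := (fourierCoeff (cosPullback F) n).re

lemma continuous_cosPullback {F : ℝ → ℝ} (hF : Continuous F) : Continuous (cosPullback F) :=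
  Complex.continuous_ofReal.comp (hF.comp Real.Angle.continuous_cos)

lemma ofReal_cosCoeff (F : ℝ → ℝ) (n : ℤ) :
    (cosCoeff F n : ℂ) = fourierCoeff (cosPullback F) n := by
  apply Complex.ext
  · simp [cosCoeff]
  · rw [fourierCoeff_im_eq_zero, Complex.ofReal_im]
    intro x
    rw [cosPullback, cosPullback, Complex.conj_ofReal]
    congr 2
    exact Real.Angle.cos_neg x

lemma cosCoeff_congr {F G : ℝ → ℝ} (h : ∀ x ∈ Set.Icc (-1 : ℝ) 1, F x = G x) :
    cosCoeff F = cosCoeff G := by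
  have : cosPullback F = cosPullback G := by
    ext x
    rw [cosPullback, cosPullback, h _ ⟨?_, ?_⟩]
    · induction x using Real.Angle.induction_on with | _ x => exact neg_one_le_cos x
    · induction x using Real.Angle.induction_on with | _ x => exact cos_le_one x
  ext n
  rw [cosCoeff, cosCoeff, this]

lemma abs_iteratedDeriv_cos_le (i : ℕ) (x : ℝ) : ‖iteratedDeriv i cos x‖ ≤ 1 := by
  obtain ⟨k, rfl | rfl⟩ := i.even_or_odd'
  · rw [iteratedDeriv_even_cos]
    simpa [abs_mul] using abs_cos_le_one x
  · rw [iteratedDeriv_odd_cos]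
    simpa [abs_mul] using abs_sin_le_one x

lemma iteratedDeriv_ofReal {f : ℝ → ℝ} {j : ℕ} (hf : ContDiff ℝ j f) (x : ℝ) :
    ‖iteratedDeriv j (fun y => (f y : ℂ)) x‖ = ‖iteratedDeriv j f x‖ := by
  rw [← norm_iteratedFDeriv_eq_norm_iteratedDeriv, ← norm_iteratedFDeriv_eq_norm_iteratedDeriv]
  exact Complex.ofRealLI.norm_iteratedFDeriv_comp_left hf.contDiffAt (le_refl _)

/-- The factor `j!` comes from the bound on derivatives of the composite `F ∘ cos`, and `2 ^ j` from
`1 + |n| ≤ 2 |n|` for `n ≠ 0`. -/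
lemma abs_cosCoeff_mul_le {F : ℝ → ℝ} {j : ℕ} (hF : ContDiff ℝ j F) {M : ℝ}
    (hM : ∀ i ≤ j, ∀ x ∈ Set.Icc (-1 : ℝ) 1, |iteratedDeriv i F x| ≤ M) (n : ℤ) :
    |cosCoeff F n| * (1 + |(n : ℝ)|) ^ j ≤ 2 ^ j * j.factorial * M := by
  have hM0 : 0 ≤ M := (abs_nonneg _).trans (hM 0 (Nat.zero_le _) 0 (by simp))
  have hcoe : (fun x : ℝ => cosPullback F (x : AddCircle (2 * π))) =
      fun x : ℝ => (((F ∘ cos) x : ℝ) : ℂ) := rfl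
  have h1 : |cosCoeff F n| = ‖fourierCoeffOn (lt_add_of_pos_right (0 : ℝ) two_pi_pos)
      (fun x : ℝ => (((F ∘ cos) x : ℝ) : ℂ)) n‖ := by
    rw [← norm_eq_abs, ← Complex.norm_real, ofReal_cosCoeff, fourierCoeff_eq_fourierCoeffOn, hcoe]
  have hcomp : ContDiff ℝ j (F ∘ cos) := hF.comp contDiff_cos
  rcases eq_or_ne n 0 with rfl | hn
  · have h2 : |cosCoeff F 0| ≤ M := by
      rw [h1]
      refine fourierCoeffOn_norm_le (fun x => ?_) 0
      simpa using hM 0 (Nat.zero_le _) (cos x) ⟨neg_one_le_cos x, cos_le_one x⟩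
    have h3 : (1 : ℝ) ≤ 2 ^ j * j.factorial :=
      one_le_mul_of_one_le_of_one_le (one_le_pow₀ (by norm_num))
        (by exact_mod_cast j.factorial_pos)
    simp only [Int.cast_zero, abs_zero, add_zero, one_pow, mul_one]
    nlinarith
  · have hbd : ∀ x, ‖iteratedDeriv j (fun x : ℝ => (((F ∘ cos) x : ℝ) : ℂ)) x‖
        ≤ j.factorial * M := fun x => by
      rw [iteratedDeriv_ofReal hcomp, ← norm_iteratedFDeriv_eq_norm_iteratedDeriv]
      have := norm_iteratedFDeriv_comp_le hF (contDiff_cos (n := j)) le_rfl x (C := M) (D := 1)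
        (fun i hi => by
          rw [norm_iteratedFDeriv_eq_norm_iteratedDeriv]
          exact hM i hi _ ⟨neg_one_le_cos x, cos_le_one x⟩)
        (fun i _ _ => by
          rw [norm_iteratedFDeriv_eq_norm_iteratedDeriv, one_pow]
          exact abs_iteratedDeriv_cos_le i x)
      simpa using this
    have h2 := fourierCoeffOn_decay j hn (Complex.ofRealCLM.contDiff.comp hcomp)
      (fun x => by simp) hbd
    have hn1 : (1 : ℝ) ≤ |(n : ℝ)| := by
      have := Int.one_le_abs hn
      exact_mod_cast this
    rw [h1]
    calc _ ≤ j.factorial * M / |(n : ℝ)| ^ j * (2 * |(n : ℝ)|) ^ j := by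
          gcongr
          · exact h2
          · linarith
      _ = _ := by
          rw [mul_pow]
          field_simp

lemma exists_iteratedDeriv_bound {F : ℝ → ℝ} (hF : ContDiff ℝ ∞ F) (j : ℕ) :
    ∃ M, ∀ i ≤ j, ∀ x ∈ Set.Icc (-1 : ℝ) 1, |iteratedDeriv i F x| ≤ M := by
  have h : ∀ i : ℕ, ∃ M, ∀ x ∈ Set.Icc (-1 : ℝ) 1, |iteratedDeriv i F x| ≤ M := fun i =>
    isCompact_Icc.exists_bound_of_continuousOn
      (hF.continuous_iteratedDeriv i (by exact_mod_cast le_top)).continuousOn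
  choose M hM using h
  exact ⟨∑ i ∈ Finset.range (j + 1), |M i|, fun i hi x hx =>
    ((hM i x hx).trans (le_abs_self _)).trans
    (Finset.single_le_sum (f := fun i => |M i|) (fun _ _ => abs_nonneg _)
      (Finset.mem_range.2 (by omega)))⟩

lemma summable_one_div_one_add_abs_sq : Summable fun n : ℤ => 1 / (1 + |(n : ℝ)|) ^ 2 := by
  -- The shift by `1 / 2` keeps every denominator nonzero, so the comparison also holds at `n = 0`.
  have h := (summable_one_div_int_add_rpow (1 / 2) 2).2 (by norm_num)
  refine .of_nonneg_of_le (fun n => by positivity) (fun n => ?_) h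
  have h0 : (n : ℝ) + 1 / 2 ≠ 0 := by
    intro h
    have : (2 * n + 1 : ℤ) = 0 := by
      have : (2 * n + 1 : ℝ) = 0 := by linarith
      exact_mod_cast this
    omega
  have h1 : 0 < |(n : ℝ) + 1 / 2| := abs_pos.2 h0
  rw [show (2 : ℝ) = ((2 : ℕ) : ℝ) by norm_num, rpow_natCast]
  gcongr
  refine (abs_add_le _ _).trans ?_
  rw [abs_of_pos (by norm_num : (0 : ℝ) < 1 / ((2 : ℕ) : ℝ))]
  norm_num
  linarith [abs_nonneg (n : ℝ)]

lemma summable_fourierCoeff_cosPullback {F : ℝ → ℝ} (hF : ContDiff ℝ ∞ F) :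
    Summable (fourierCoeff (cosPullback F)) := by
  obtain ⟨M, hM⟩ := exists_iteratedDeriv_bound hF 2
  refine .of_norm_bounded (summable_one_div_one_add_abs_sq.mul_left
    (2 ^ 2 * (Nat.factorial 2 : ℝ) * M)) fun n => ?_
  rw [← ofReal_cosCoeff, Complex.norm_real, norm_eq_abs, mul_one_div, le_div_iff₀ (by positivity)]
  exact abs_cosCoeff_mul_le (contDiff_infty.1 hF 2) hM n

lemma hasSum_cosCoeff_mul {F G : ℝ → ℝ} (hF : ContDiff ℝ ∞ F) (hG : ContDiff ℝ ∞ G) (n : ℤ) :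
    HasSum (fun m => cosCoeff F m * cosCoeff G (n - m)) (cosCoeff (fun x => F x * G x) n) := by
  have h := hasSum_fourierCoeff_mul (f := ⟨_, continuous_cosPullback hF.continuous⟩)
    (summable_fourierCoeff_cosPullback hF) ⟨_, continuous_cosPullback hG.continuous⟩ n
  have he : (fun x => cosPullback F x * cosPullback G x) = cosPullback (fun x => F x * G x) := by
    ext x
    simp [cosPullback]
  simp only [ContinuousMap.coe_mk] at h
  rw [he] at h
  simp only [← ofReal_cosCoeff] at h
  exact_mod_cast h

lemma cosCoeff_add {F G : ℝ → ℝ} (hF : Continuous F) (hG : Continuous G) (n : ℤ) :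
    cosCoeff (fun x => F x + G x) n = cosCoeff F n + cosCoeff G n := by
  have hint : ∀ {F : ℝ → ℝ}, Continuous F → Integrable (cosPullback F) haarAddCircle := fun hF =>
    (continuous_cosPullback hF).integrable_of_hasCompactSupport
      (HasCompactSupport.of_compactSpace _)
  have he : cosPullback (fun x => F x + G x) = cosPullback F + cosPullback G := by
    ext x
    simp [cosPullback]
  rw [cosCoeff, he, fourierCoeff.add (hint hF) (hint hG)]
  simp [cosCoeff]

lemma cosCoeff_const (c : ℝ) : cosCoeff (fun _ => c) = Pi.single 0 c := by
  have he : cosPullback (fun _ => c) = (c : ℂ) • ⇑(fourier (T := 2 * π) 0) := by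
    ext x
    simp [cosPullback]
  ext n
  rw [cosCoeff, he]
  erw [fourierCoeff.const_smul]
  rw [fourierCoeff_fourier]
  by_cases h : n = 0 <;> simp [h]

lemma cosCoeff_id : cosCoeff (fun x => x) = Pi.single 1 (1 / 2) + Pi.single (-1) (1 / 2) := by
  have hint : ∀ n : ℤ, Integrable (⇑(fourier (T := 2 * π) n)) haarAddCircle := fun n =>
    (fourier (T := 2 * π) n).continuous.integrable_of_hasCompactSupport
      (HasCompactSupport.of_compactSpace _)
  have he : cosPullback (fun x => x) =
      (1 / 2 : ℂ) • (⇑(fourier (T := 2 * π) 1) + ⇑(fourier (T := 2 * π) (-1))) := by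
    ext x
    induction x using QuotientAddGroup.induction_on with | _ x =>
    have h1 := fourier_coe_apply (T := 2 * π) (n := 1) (x := x)
    have h2 := fourier_coe_apply (T := 2 * π) (n := -1) (x := x)
    have hx : cosPullback (fun x => x) (x : AddCircle (2 * π)) = ((cos x : ℝ) : ℂ) := rfl
    have hp : (π : ℂ) ≠ 0 := by exact_mod_cast pi_ne_zero
    erw [hx, Pi.smul_apply, Pi.add_apply, h1, h2, Complex.ofReal_cos, Complex.cos]
    have e1 : 2 * (π : ℂ) * Complex.I * ((1 : ℤ) : ℂ) * x / ((2 * π : ℝ) : ℂ) = x * Complex.I := by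
      push_cast; field_simp
    have e2 : 2 * (π : ℂ) * Complex.I * ((-1 : ℤ) : ℂ) * x / ((2 * π : ℝ) : ℂ)
        = -x * Complex.I := by
      push_cast; field_simp
    rw [e1, e2, smul_eq_mul]
    ring
  ext n
  rw [cosCoeff, he]
  erw [fourierCoeff.const_smul]
  rw [fourierCoeff.add (hint _) (hint _), Pi.add_apply, fourierCoeff_fourier, fourierCoeff_fourier]
  by_cases h : n = 1
  · subst h; simp
  · by_cases h' : n = -1
    · subst h'; simp
    · simp [h, h']

end Coefficients

/-! ### The functional calculus, its support and its finite order. -/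

section Calculus

variable {A : Type*} [NormedRing A] [NormedAlgebra ℝ A]

/-- The smooth functional calculus of `(T + T⁻¹) / 2`, for `T` with polynomially bounded powers. -/
noncomputable def cosCalculus (T : Aˣ) (F : ℝ → ℝ) : A :=
  ∑' n : ℤ, cosCoeff F n • ((T ^ n : Aˣ) : A)

lemma cosCalculus_congr (T : Aˣ) {F G : ℝ → ℝ} (h : ∀ x ∈ Set.Icc (-1 : ℝ) 1, F x = G x) :
    cosCalculus T F = cosCalculus T G := by
  rw [cosCalculus, cosCalculus, cosCoeff_congr h]

lemma cosCalculus_const (T : Aˣ) (c : ℝ) : cosCalculus T (fun _ => c) = c • 1 := by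
  rw [cosCalculus, cosCoeff_const, tsum_eq_single 0 (fun n hn => by simp [hn])]
  simp

lemma cosCalculus_zero (T : Aˣ) {F : ℝ → ℝ} (h : ∀ x ∈ Set.Icc (-1 : ℝ) 1, F x = 0) :
    cosCalculus T F = 0 := by
  rw [cosCalculus_congr T (G := fun _ => 0) h, cosCalculus_const, zero_smul]

lemma cosCalculus_id (T : Aˣ) :
    cosCalculus T (fun x => x) = (1 / 2 : ℝ) • ((T : A) + ((T⁻¹ : Aˣ) : A)) := by
  rw [cosCalculus, cosCoeff_id, tsum_eq_sum (s := {1, -1}) (fun n hn => ?_),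
    Finset.sum_pair (by norm_num)]
  · simp
  · simp only [Finset.mem_insert, Finset.mem_singleton, not_or] at hn
    simp [hn.1, hn.2]

lemma norm_cosCoeff_smul_le {T : Aˣ} {C : ℝ} {K : ℕ}
    (hT : ∀ n : ℤ, ‖((T ^ n : Aˣ) : A)‖ ≤ C * (1 + |(n : ℝ)|) ^ K) {F : ℝ → ℝ}
    (hF : ContDiff ℝ ∞ F) {M : ℝ}
    (hM : ∀ i ≤ K + 2, ∀ x ∈ Set.Icc (-1 : ℝ) 1, |iteratedDeriv i F x| ≤ M) (n : ℤ) :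
    ‖cosCoeff F n • ((T ^ n : Aˣ) : A)‖ ≤
      2 ^ (K + 2) * (K + 2).factorial * M * C * (1 / (1 + |(n : ℝ)|) ^ 2) := by
  have h := abs_cosCoeff_mul_le (contDiff_infty.1 hF (K + 2)) hM n
  have hC : 0 ≤ C := by simpa using (norm_nonneg _).trans (hT 0)
  rw [norm_smul, norm_eq_abs, mul_one_div, le_div_iff₀ (by positivity)]
  calc _ ≤ |cosCoeff F n| * (C * (1 + |(n : ℝ)|) ^ K) * (1 + |(n : ℝ)|) ^ 2 := by
        gcongr; exact hT n
    _ = (|cosCoeff F n| * (1 + |(n : ℝ)|) ^ (K + 2)) * C := by ring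
    _ ≤ _ := by gcongr

lemma summable_norm_cosCoeff_smul {T : Aˣ} {C : ℝ} {K : ℕ}
    (hT : ∀ n : ℤ, ‖((T ^ n : Aˣ) : A)‖ ≤ C * (1 + |(n : ℝ)|) ^ K) {F : ℝ → ℝ}
    (hF : ContDiff ℝ ∞ F) : Summable fun n : ℤ => ‖cosCoeff F n • ((T ^ n : Aˣ) : A)‖ := by
  obtain ⟨M, hM⟩ := exists_iteratedDeriv_bound hF (K + 2)
  exact .of_nonneg_of_le (fun _ => norm_nonneg _) (norm_cosCoeff_smul_le hT hF hM)
    (summable_one_div_one_add_abs_sq.mul_left _)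

/-- Of the `K + 2` derivatives, `K` offset the growth of `T ^ n` and two make the series summable.
-/
lemma exists_norm_cosCalculus_le {T : Aˣ} {C : ℝ} {K : ℕ}
    (hT : ∀ n : ℤ, ‖((T ^ n : Aˣ) : A)‖ ≤ C * (1 + |(n : ℝ)|) ^ K) :
    ∃ D : ℝ, ∀ F : ℝ → ℝ, ContDiff ℝ ∞ F → ∀ M : ℝ,
      (∀ i ≤ K + 2, ∀ x ∈ Set.Icc (-1 : ℝ) 1, |iteratedDeriv i F x| ≤ M) →
        ‖cosCalculus T F‖ ≤ D * M := by
  refine ⟨2 ^ (K + 2) * (K + 2).factorial * C * ∑' n : ℤ, 1 / (1 + |(n : ℝ)|) ^ 2,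
    fun F hF M hM => ?_⟩
  have hs := summable_one_div_one_add_abs_sq.mul_left
    (2 ^ (K + 2) * ((K + 2).factorial : ℝ) * M * C)
  refine (tsum_of_norm_bounded hs.hasSum (norm_cosCoeff_smul_le hT hF hM)).trans_eq ?_
  rw [tsum_mul_left]
  ring

variable [CompleteSpace A]

lemma cosCalculus_add {T : Aˣ} {C : ℝ} {K : ℕ}
    (hT : ∀ n : ℤ, ‖((T ^ n : Aˣ) : A)‖ ≤ C * (1 + |(n : ℝ)|) ^ K) {F G : ℝ → ℝ}
    (hF : ContDiff ℝ ∞ F) (hG : ContDiff ℝ ∞ G) :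
    cosCalculus T (fun x => F x + G x) = cosCalculus T F + cosCalculus T G := by
  rw [cosCalculus, cosCalculus, cosCalculus,
    ← (summable_norm_cosCoeff_smul hT hF).of_norm.tsum_add
      (summable_norm_cosCoeff_smul hT hG).of_norm]
  simp only [cosCoeff_add hF.continuous hG.continuous, add_smul]

lemma cosCalculus_mul {T : Aˣ} {C : ℝ} {K : ℕ}
    (hT : ∀ n : ℤ, ‖((T ^ n : Aˣ) : A)‖ ≤ C * (1 + |(n : ℝ)|) ^ K) {F G : ℝ → ℝ}
    (hF : ContDiff ℝ ∞ F) (hG : ContDiff ℝ ∞ G) :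
    cosCalculus T (fun x => F x * G x) = cosCalculus T F * cosCalculus T G := by
  have hsF := summable_norm_cosCoeff_smul hT hF
  have hsG := summable_norm_cosCoeff_smul hT hG
  have hs := (summable_mul_of_summable_norm hsF hsG)
  -- Reindex the double sum by total degree, so that the inner sum is the convolution.
  let e : ℤ × ℤ ≃ ℤ × ℤ :=
    { toFun := fun p => (p.2, p.1 - p.2)
      invFun := fun p => (p.1 + p.2, p.1)
      left_inv := fun p => by ext <;> simp
      right_inv := fun p => by ext <;> simp }
  have hs' := (e.summable_iff).2 hs
  rw [cosCalculus, cosCalculus, cosCalculus]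
  refine Eq.trans ?_ ((tsum_mul_tsum_of_summable_norm hsF hsG).trans
    ((e.tsum_eq _).symm.trans hs'.tsum_prod)).symm
  congr 1
  ext n
  rw [← ((hasSum_cosCoeff_mul hF hG n).smul_const ((T ^ n : Aˣ) : A)).tsum_eq]
  refine tsum_congr fun m => ?_
  simp only [Function.comp_apply, e, Equiv.coe_fn_mk]
  rw [smul_mul_smul_comm, ← Units.val_mul, ← zpow_add]
  congr 4
  ring

lemma cosCalculus_pow {T : Aˣ} {C : ℝ} {K : ℕ}
    (hT : ∀ n : ℤ, ‖((T ^ n : Aˣ) : A)‖ ≤ C * (1 + |(n : ℝ)|) ^ K) {F : ℝ → ℝ}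
    (hF : ContDiff ℝ ∞ F) (m : ℕ) :
    cosCalculus T (fun x => F x ^ m) = cosCalculus T F ^ m := by
  induction m with
  | zero => simpa using cosCalculus_const T 1
  | succ m ih =>
    simp only [pow_succ]
    rw [cosCalculus_mul hT (hF.pow m) hF, ih]

lemma commute_cosCalculus {T : Aˣ} {C : ℝ} {K : ℕ}
    (hT : ∀ n : ℤ, ‖((T ^ n : Aˣ) : A)‖ ≤ C * (1 + |(n : ℝ)|) ^ K) {F : ℝ → ℝ}
    (hF : ContDiff ℝ ∞ F) : Commute (T : A) (cosCalculus T F) := by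
  have hs := (summable_norm_cosCoeff_smul hT hF).of_norm
  rw [commute_iff_eq, cosCalculus, ← hs.tsum_mul_left, ← hs.tsum_mul_right]
  refine tsum_congr fun n => ?_
  rw [mul_smul_comm, smul_mul_assoc, ← Units.val_mul, ← Units.val_mul,
    (Commute.self_zpow T n).eq]

/-- If the functional calculus annihilates all smooth functions that vanish near `t`, then
`(T + T⁻¹) / 2 - t` is nilpotent. -/
lemma isNilpotent_of_local {T : Aˣ} {C : ℝ} {K : ℕ}
    (hT : ∀ n : ℤ, ‖((T ^ n : Aˣ) : A)‖ ≤ C * (1 + |(n : ℝ)|) ^ K) {t : ℝ}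
    (ht : ∀ δ > 0, ∀ F : ℝ → ℝ, ContDiff ℝ ∞ F → (∀ x, |x - t| ≤ δ → F x = 0) →
      cosCalculus T F = 0) :
    IsNilpotent ((1 / 2 : ℝ) • ((T : A) + ((T⁻¹ : Aˣ) : A)) - t • 1) := by
  refine ⟨K + 3, ?_⟩
  have hlin : ContDiff ℝ ∞ fun x : ℝ => x + -t := contDiff_id.add contDiff_const
  have h1 : cosCalculus T (fun x => x + -t) =
      (1 / 2 : ℝ) • ((T : A) + ((T⁻¹ : Aˣ) : A)) - t • 1 := by
    rw [cosCalculus_add hT (F := fun x => x) contDiff_id contDiff_const, cosCalculus_id,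
      cosCalculus_const, neg_smul, sub_eq_add_neg]
  rw [← h1, ← cosCalculus_pow hT hlin]
  let φ : ContDiffBump (0 : ℝ) := ⟨1, 2, one_pos, one_lt_two⟩
  -- Near `t`, `(x - t) ^ (K + 3)` agrees with `ε ^ (K + 3) * G ((x - t) / ε)`, which is small in
  -- the norm controlling the calculus.
  let G : ℝ → ℝ := fun u => u ^ (K + 3) * φ u
  have hG : ContDiff ℝ ∞ G := (contDiff_id.pow _).mul φ.contDiff
  have hGc : HasCompactSupport G := φ.hasCompactSupport.mul_left
  obtain ⟨M, hM⟩ : ∃ M, ∀ i ≤ K + 2, ∀ x, |iteratedDeriv i G x| ≤ M := by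
    have h : ∀ i : ℕ, ∃ M, ∀ x, |iteratedDeriv i G x| ≤ M := fun i => by
      obtain ⟨M, hM⟩ := (hGc.iteratedFDeriv (𝕜 := ℝ) i).exists_bound_of_continuous
        (hG.continuous_iteratedFDeriv (by exact_mod_cast le_top))
      exact ⟨M, fun x => by
        rw [← norm_eq_abs, ← norm_iteratedFDeriv_eq_norm_iteratedDeriv]; exact hM x⟩
    choose M hM using h
    have hle : ∀ i ≤ K + 2, |M i| ≤ ∑ i ∈ Finset.range (K + 2 + 1), |M i| := fun i hi =>
      Finset.single_le_sum (f := fun i => |M i|) (fun _ _ => abs_nonneg _)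
        (Finset.mem_range.2 (by omega))
    exact ⟨_, fun i hi x =>
      ((hM i x).trans (le_abs_self _)).trans (hle i hi)⟩
  obtain ⟨D, hD⟩ := exists_norm_cosCalculus_le hT
  have key : ∀ ε : ℝ, 0 < ε → ε ≤ 1 →
      ‖cosCalculus T (fun x => (x + -t) ^ (K + 3))‖ ≤ D * (ε * M) := by
    intro ε hε hε1
    let H : ℝ → ℝ := fun x => ε ^ (K + 3) * G (ε⁻¹ * (x - t))
    have hH : ContDiff ℝ ∞ H :=
      contDiff_const.mul (hG.comp (contDiff_const.mul (contDiff_id.sub contDiff_const)))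
    have hsub : cosCalculus T (fun x => (x + -t) ^ (K + 3) + -H x) = 0 := by
      refine ht ε hε _ ((hlin.pow _).add hH.neg) fun x hx => ?_
      have hφ : φ (ε⁻¹ * (x - t)) = 1 := by
        apply φ.one_of_mem_closedBall
        rw [mem_closedBall_zero_iff, norm_mul, norm_inv, norm_eq_abs, norm_eq_abs, abs_of_pos hε,
          inv_mul_le_iff₀ hε]
        simpa [φ] using hx
      simp only [H, G, hφ, mul_pow, inv_pow]
      field_simp
      ring
    have heq : cosCalculus T (fun x => (x + -t) ^ (K + 3)) = cosCalculus T H := by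
      rw [← zero_add (cosCalculus T H), ← hsub,
        ← cosCalculus_add hT ((hlin.pow _).add hH.neg) hH]
      simp
    rw [heq]
    refine hD H hH _ fun i hi x _ => ?_
    have hder : iteratedDeriv i H x =
        ε ^ (K + 3) * ((ε⁻¹) ^ i * iteratedDeriv i G (ε⁻¹ * (x - t))) := by
      have hGi : ContDiff ℝ i G := contDiff_infty.1 hG i
      have e1 := iteratedDeriv_comp_sub_const i (fun y => G (ε⁻¹ * y)) t
      have e2 := iteratedDeriv_comp_const_mul hGi ε⁻¹
      have e3 : iteratedDeriv i H x =
          ε ^ (K + 3) * iteratedDeriv i (fun x => G (ε⁻¹ * (x - t))) x :=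
        iteratedDeriv_const_mul_field _ _
      rw [e3, e1, e2]
    rw [hder, abs_mul, abs_mul, abs_of_pos (by positivity : 0 < ε ^ (K + 3)),
      abs_of_pos (by positivity : 0 < ε⁻¹ ^ i), ← mul_assoc]
    -- The exponent `K + 3` exceeds the order `K + 2`, so one factor `ε` survives.
    have hpow : ε ^ (K + 3) * ε⁻¹ ^ i ≤ ε := by
      obtain ⟨k, hk⟩ := Nat.exists_eq_add_of_le hi
      have : ε ^ (K + 3) * ε⁻¹ ^ i = ε ^ (k + 1) := by
        rw [show K + 3 = i + (k + 1) by omega, pow_add, inv_pow]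
        field_simp
      rw [this]
      exact pow_le_of_le_one hε.le hε1 (by omega)
    exact mul_le_mul hpow (hM i hi _) (abs_nonneg _) hε.le
  have hlim : Tendsto (fun ε : ℝ => D * (ε * M)) (𝓝[>] 0) (𝓝 0) := by
    have : Continuous fun ε : ℝ => D * (ε * M) := by fun_prop
    simpa using (this.tendsto 0).mono_left nhdsWithin_le_nhds
  have hev : ∀ᶠ ε : ℝ in 𝓝[>] 0,
      ‖cosCalculus T (fun x => (x + -t) ^ (K + 3))‖ ≤ D * (ε * M) := by
    filter_upwards [Ioc_mem_nhdsGT (zero_lt_one' ℝ)] with ε hε using key ε hε.1 hε.2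
  exact norm_le_zero_iff.1 (ge_of_tendsto hlim hev)

/-- If the calculus takes no two nonzero values on smooth functions with product zero, then it is
concentrated at a single point. -/
lemma exists_local_of_prime [Nontrivial A] {T : Aˣ} {C : ℝ} {K : ℕ}
    (hT : ∀ n : ℤ, ‖((T ^ n : Aˣ) : A)‖ ≤ C * (1 + |(n : ℝ)|) ^ K)
    (hprime : ∀ F G : ℝ → ℝ, ContDiff ℝ ∞ F → ContDiff ℝ ∞ G → (∀ x, F x * G x = 0) →
      cosCalculus T F = 0 ∨ cosCalculus T G = 0) :
    ∃ t : ℝ, ∀ δ > 0, ∀ F : ℝ → ℝ, ContDiff ℝ ∞ F → (∀ x, |x - t| ≤ δ → F x = 0) →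
      cosCalculus T F = 0 := by
  -- The supremum of `S` is the left end of the support of the calculus.
  let S : Set ℝ := {t | ∀ F : ℝ → ℝ, ContDiff ℝ ∞ F → (∀ x, t ≤ x → F x = 0) →
    cosCalculus T F = 0}
  have hstep : ∀ a b : ℝ, a < b → ∃ s : ℝ → ℝ, ContDiff ℝ ∞ s ∧ (∀ x ≤ a, s x = 0) ∧
      ∀ x, b ≤ x → s x = 1 := fun a b hab => by
    refine ⟨fun x => smoothTransition ((x - a) / (b - a)),
      smoothTransition.contDiff.comp ((contDiff_id.sub contDiff_const).div_const _),
      fun x hx => smoothTransition.zero_of_nonpos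
        (div_nonpos_of_nonpos_of_nonneg (by linarith) (by linarith)),
      fun x hx => smoothTransition.one_of_one_le ?_⟩
    rw [le_div_iff₀ (by linarith)]
    linarith
  have hne : S.Nonempty :=
    ⟨-1, fun F _ h => cosCalculus_zero T fun x hx => h x hx.1⟩
  have hub : BddAbove S := by
    refine ⟨2, fun t ht => ?_⟩
    by_contra! h
    obtain ⟨s, hs, hs0, hs1⟩ := hstep 1 2 (by norm_num)
    have h0 : cosCalculus T (fun x => 1 - s x) = 0 :=
      ht _ (contDiff_const.sub hs) fun x hx => by rw [hs1 x (h.le.trans hx), sub_self]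
    rw [cosCalculus_congr T (G := fun _ => 1) (fun x hx => by rw [hs0 x hx.2, sub_zero]),
      cosCalculus_const, one_smul] at h0
    exact one_ne_zero h0
  refine ⟨sSup S, fun δ hδ F hF h0 => ?_⟩
  set t := sSup S
  obtain ⟨s, hs, hs0, hs1⟩ := hstep (t - δ) (t + δ) (by linarith)
  have hsplit : F = fun x => F x * (1 - s x) + F x * s x := by
    ext x
    ring
  have hleft : cosCalculus T (fun x => F x * (1 - s x)) = 0 := by
    obtain ⟨r, hr, htr⟩ := exists_lt_of_lt_csSup hne (show t - δ < sSup S by simp only [t]; linarith)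
    refine hr _ (hF.mul (contDiff_const.sub hs)) fun x hx => ?_
    rcases le_or_gt x (t + δ) with h | h
    · rw [h0 x (abs_le.2 ⟨by linarith, by linarith⟩), zero_mul]
    · rw [hs1 x h.le, sub_self, mul_zero]
  have hright : cosCalculus T (fun x => F x * s x) = 0 := by
    -- Some `H` living left of `t + δ` is not annihilated; its product with the right part of `F` is
    -- zero, so primality annihilates that part.
    have hn : t + δ ∉ S := fun h => by
      have := le_csSup hub h
      simp only [t] at this
      linarith
    simp only [S, Set.mem_ofPred_eq, not_forall] at hn
    obtain ⟨H, hH, hH0, hHne⟩ := hn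
    refine (hprime _ H (hF.mul hs) hH fun x => ?_).resolve_right hHne
    rcases le_or_gt (t + δ) x with h | h
    · rw [hH0 x h, mul_zero]
    · rcases le_or_gt x (t - δ) with h' | h'
      · rw [hs0 x h', mul_zero, zero_mul]
      · rw [h0 x (abs_le.2 ⟨by linarith, by linarith⟩), zero_mul, zero_mul]
  rw [hsplit, cosCalculus_add hT (hF.mul (contDiff_const.sub hs)) (hF.mul hs), hleft, hright,
    add_zero]

end Calculus

/-! ### Constructing invariant subspaces. -/

section InvariantSubspace

variable {X : Type*} [NormedAddCommGroup X] [NormedSpace ℝ X]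

lemma hasInvariantSubspace_of_commute {T R : X →L[ℝ] X} (hc : Commute T R) (h0 : R ≠ 0)
    {x : X} (hx : x ≠ 0) (hRx : R x = 0) : HasInvariantSubspace T := by
  refine ⟨R.ker, R.isClosed_ker, fun h => hx ?_, fun h => h0 ?_, fun y hy => ?_⟩
  · exact (Submodule.eq_bot_iff _).1 h x hRx
  · ext y
    have : y ∈ (⊤ : Submodule ℝ X) := trivial
    rw [← h] at this
    exact this
  · have h1 : T (R y) = R (T y) := congrArg (fun Q : X →L[ℝ] X => Q y) hc.eq
    have h2 : R y = 0 := hy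
    change R (T y) = 0
    rw [← h1, h2, map_zero]

lemma hasInvariantSubspace_of_quadratic (hX : 2 < Module.rank ℝ X) {T : X →L[ℝ] X} {a b : ℝ}
    (h : ∀ x, T (T x) = a • T x + b • x) : HasInvariantSubspace T := by
  have : Nontrivial X := by
    rw [← rank_pos_iff_nontrivial (R := ℝ)]
    exact lt_trans (by norm_num) hX
  obtain ⟨x, hx⟩ := exists_ne (0 : X)
  have : FiniteDimensional ℝ (Submodule.span ℝ ({x, T x} : Set X)) :=
    FiniteDimensional.span_of_finite ℝ (Set.toFinite _)
  refine ⟨Submodule.span ℝ {x, T x}, Submodule.closed_of_finiteDimensional _, fun h => hx ?_,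
    fun h => ?_, fun y hy => ?_⟩
  · exact (Submodule.eq_bot_iff _).1 h x (Submodule.subset_span (by simp))
  · have h1 := rank_span_le (R := ℝ) ({x, T x} : Set X)
    rw [h, rank_top] at h1
    have h2 : Cardinal.mk ({x, T x} : Set X) ≤ 2 := by
      refine (Cardinal.mk_insert_le).trans ?_
      rw [Cardinal.mk_singleton, one_add_one_eq_two]
    exact absurd hX (not_lt.2 (h1.trans h2))
  · obtain ⟨c, d, rfl⟩ := Submodule.mem_span_pair.1 hy
    rw [map_add, map_smul, map_smul, h]
    have h1 : x ∈ Submodule.span ℝ ({x, T x} : Set X) := Submodule.subset_span (by simp)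
    have h2 : T x ∈ Submodule.span ℝ ({x, T x} : Set X) := Submodule.subset_span (by simp)
    exact add_mem (Submodule.smul_mem _ _ h2)
      (Submodule.smul_mem _ _ (add_mem (Submodule.smul_mem _ _ h2) (Submodule.smul_mem _ _ h1)))

lemma hasInvariantSubspace_of_polynomial_growth [CompleteSpace X] (hX : 2 < Module.rank ℝ X)
    (T : (X →L[ℝ] X)ˣ) {C : ℝ} {K : ℕ}
    (hT : ∀ n : ℤ, ‖((T ^ n : (X →L[ℝ] X)ˣ) : X →L[ℝ] X)‖ ≤ C * (1 + |(n : ℝ)|) ^ K) :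
    HasInvariantSubspace (T : X →L[ℝ] X) := by
  have : Nontrivial X := by
    rw [← rank_pos_iff_nontrivial (R := ℝ)]
    exact lt_trans (by norm_num) hX
  by_contra hno
  have hprime : ∀ F G : ℝ → ℝ, ContDiff ℝ ∞ F → ContDiff ℝ ∞ G → (∀ x, F x * G x = 0) →
      cosCalculus T F = 0 ∨ cosCalculus T G = 0 := by
    intro F G hF hG hFG
    by_contra! h
    have hmul := cosCalculus_mul hT hF hG
    rw [cosCalculus_zero T fun x _ => hFG x] at hmul
    obtain ⟨y, hy⟩ : ∃ y, cosCalculus T G y ≠ 0 := by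
      by_contra! hall
      exact h.2 (ContinuousLinearMap.ext hall)
    exact hno (hasInvariantSubspace_of_commute (commute_cosCalculus hT hF) h.1 hy
      (congrArg (fun Q : X →L[ℝ] X => Q y) hmul).symm)
  obtain ⟨t, ht⟩ := exists_local_of_prime hT hprime
  have hnil := isNilpotent_of_local hT ht
  set N : X →L[ℝ] X :=
    (1 / 2 : ℝ) • ((T : X →L[ℝ] X) + ((T⁻¹ : (X →L[ℝ] X)ˣ) : X →L[ℝ] X)) - t • 1 with hN
  have hcomm : Commute (T : X →L[ℝ] X) N := by
    refine (((Commute.refl _).add_right ?_).smul_right _).sub_right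
      ((Commute.one_right _).smul_right _)
    rw [commute_iff_eq, Units.mul_inv, Units.inv_mul]
  by_cases h0 : N = 0
  · refine hno (hasInvariantSubspace_of_quadratic hX (a := 2 * t) (b := -1) fun x => ?_)
    -- Evaluating at `T x` rather than `x` clears the inverse.
    have h1 : N ((T : X →L[ℝ] X) x) = 0 := by rw [h0]; rfl
    have h2 : ((T⁻¹ : (X →L[ℝ] X)ˣ) : X →L[ℝ] X) ((T : X →L[ℝ] X) x) = x :=
      congrArg (fun Q : X →L[ℝ] X => Q x) T.inv_mul
    simp only [hN, sub_apply, smul_apply,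
      add_apply, one_apply_eq_self, h2] at h1
    have h3 : (T : X →L[ℝ] X) ((T : X →L[ℝ] X) x) = (2 * t) • (T : X →L[ℝ] X) x + (-1 : ℝ) • x +
        (2 : ℝ) • ((1 / 2 : ℝ) • ((T : X →L[ℝ] X) ((T : X →L[ℝ] X) x) + x)
          - t • (T : X →L[ℝ] X) x) := by
      module
    rw [h3, h1, smul_zero, add_zero]
  · obtain ⟨x, hx, hNx⟩ : ∃ x, x ≠ 0 ∧ N x = 0 := by
      by_contra! hinj
      obtain ⟨m, hm⟩ := hnil
      obtain ⟨x, hx⟩ := exists_ne (0 : X)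
      have : ∀ k : ℕ, (N ^ k) x ≠ 0 := fun k => by
        induction k with
        | zero => simpa using hx
        | succ k ih =>
          rw [pow_succ', mul_apply_eq_comp]
          exact hinj _ ih
      exact this m (by rw [hm]; rfl)
    exact hno (hasInvariantSubspace_of_commute hcomm h0 hx hNx)

lemma exists_polynomial_bound_of_isLittleO {u : ℤ → ℝ} {k : ℝ}
    (h : u =o[atTop ⊔ atBot] fun n : ℤ => |(n : ℝ)| ^ k) :
    ∃ (C : ℝ) (K : ℕ), ∀ n : ℤ, u n ≤ C * (1 + |(n : ℝ)|) ^ K := by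
  have hev := h.bound one_pos
  rw [sup_comm, ← Int.cofinite_eq, eventually_cofinite] at hev
  -- The sum absorbs the finitely many `n` where the asymptotic bound fails; the natural ceiling
  -- also covers negative `k`.
  refine ⟨1 + ∑ n ∈ hev.toFinset, |u n|, ⌈k⌉₊, fun n => ?_⟩
  have hs : 0 ≤ ∑ n ∈ hev.toFinset, |u n| := Finset.sum_nonneg fun _ _ => abs_nonneg _
  have hw : 1 ≤ (1 + |(n : ℝ)|) ^ ⌈k⌉₊ := one_le_pow₀ (by linarith [abs_nonneg (n : ℝ)])
  by_cases hn : n ∈ hev.toFinset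
  · have h1 : |u n| ≤ ∑ n ∈ hev.toFinset, |u n| :=
      Finset.single_le_sum (f := fun n => |u n|) (fun _ _ => abs_nonneg _) hn
    nlinarith [le_abs_self (u n)]
  · simp only [Set.Finite.mem_toFinset, Set.mem_ofPred_eq, not_not, one_mul] at hn
    have h2 : ‖|(n : ℝ)| ^ k‖ ≤ (1 + |(n : ℝ)|) ^ ⌈k⌉₊ := by
      rw [norm_of_nonneg (by positivity)]
      rcases eq_or_ne n 0 with rfl | h0
      · refine le_trans ?_ hw
        rw [Int.cast_zero, abs_zero]
        exact zero_rpow_le_one k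
      · have h1 : (1 : ℝ) ≤ |(n : ℝ)| := by exact_mod_cast Int.one_le_abs h0
        calc |(n : ℝ)| ^ k ≤ |(n : ℝ)| ^ ((⌈k⌉₊ : ℕ) : ℝ) :=
              rpow_le_rpow_of_exponent_le h1 (Nat.le_ceil k)
          _ = |(n : ℝ)| ^ ⌈k⌉₊ := rpow_natCast _ _
          _ ≤ _ := by gcongr; linarith
    have h3 : u n ≤ (1 + |(n : ℝ)|) ^ ⌈k⌉₊ := ((le_abs_self _).trans hn).trans h2
    nlinarith

lemma LinearIsometryEquiv.hasInvariantSubspace [CompleteSpace X] (hX : 2 < Module.rank ℝ X)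
    (e : X ≃ₗᵢ[ℝ] X) : HasInvariantSubspace (e.toContinuousLinearEquiv : X →L[ℝ] X) := by
  let φ : (X ≃ₗᵢ[ℝ] X) →* (X →L[ℝ] X) :=
    { toFun := fun g => (g.toContinuousLinearEquiv : X →L[ℝ] X)
      map_one' := rfl
      map_mul' := fun _ _ => rfl }
  let T : (X →L[ℝ] X)ˣ := φ.toHomUnits e
  refine hasInvariantSubspace_of_polynomial_growth hX T (C := 1) (K := 0) fun n => ?_
  have h : T ^ n = φ.toHomUnits (e ^ n) := (map_zpow _ _ _).symm
  rw [h, pow_zero, mul_one]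
  exact ContinuousLinearMap.opNorm_le_bound _ zero_le_one fun x => by
    rw [one_mul]
    exact ((e ^ n).norm_map x).le

lemma LinearIsometry.hasInvariantSubspace [CompleteSpace X] (hX : 2 < Module.rank ℝ X)
    (T : X →ₗᵢ[ℝ] X) : HasInvariantSubspace T.toContinuousLinearMap := by
  by_cases hs : Function.Surjective T
  · exact (LinearIsometryEquiv.ofSurjective T hs).hasInvariantSubspace hX
  · have : Nontrivial X := by
      rw [← rank_pos_iff_nontrivial (R := ℝ)]
      exact lt_trans (by norm_num) hX
    obtain ⟨x, hx⟩ := exists_ne (0 : X)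
    -- The range is closed because `X` is complete and `T` is isometric.
    refine ⟨T.toLinearMap.range, ?_, fun h => hx ?_, fun h => hs ?_, fun y _ => ⟨y, rfl⟩⟩
    · exact T.isometry.isClosedEmbedding.isClosed_range
    · have : T x = 0 := (Submodule.eq_bot_iff _).1 h _ ⟨x, rfl⟩
      exact (map_eq_zero_iff T T.injective).1 this
    · exact LinearMap.range_eq_top.1 h

end InvariantSubspace

theorem theorem1 {X : Type*} [NormedAddCommGroup X] [NormedSpace ℝ X] [CompleteSpace X]
    (hX : 2 < Module.rank ℝ X) :
    (∀ (T : (X →L[ℝ] X)ˣ) (k : ℝ),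
      (fun n : ℤ => ‖((T ^ n : (X →L[ℝ] X)ˣ) : X →L[ℝ] X)‖)
          =o[atTop ⊔ atBot] (fun n : ℤ => |(n : ℝ)| ^ k) →
        HasInvariantSubspace (T : X →L[ℝ] X)) ∧
    (∀ T : X →ₗᵢ[ℝ] X, HasInvariantSubspace T.toContinuousLinearMap) := by
  refine ⟨fun T k h => ?_, fun T => T.hasInvariantSubspace hX⟩
  obtain ⟨C, K, hT⟩ := exists_polynomial_bound_of_isLittleO h
  exact hasInvariantSubspace_of_polynomial_growth hX T hT
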